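/- For $1\le p<\infty$ let $X^p(\mathbb{R}_+)$ be the space of (classes of) measurable functions $f:\mathbb{R}_+\to\mathbb{C}$ with $\|f\|_{X^p}=\left(\int_0^\infty |f(x)|^p\,\frac{dx}{x}\right)^{1/p}<\infty$. On it consider the $C_0$-group of isometries $U(t)f(x)=f(e^t x)$, $t\in\mathbb{R}$, and let $\Theta=x\frac{d}{dx}$ be its infinitesimal generator, with $\mathcal{D}^k(\Theta)$ the domain of $\Theta^k$ and $\mathcal{D}^\infty(\Theta)=\bigcap_k\mathcal{D}^k(\Theta)$. For $\sigma>0$ the Bernstein space $\mathbf{B}^p_\sigma(\Theta)$ is the set of all $f\in\mathcal{D}^\infty(\Theta)$ with $\|\Theta^k f\|_{X^p}\le\sigma^k\|f\|_{X^p}$ for all $k\in\mathbb{N}$. For $\sigma>0$ and $m\ge 1$ the Riesz–Boas operators are $$\mathcal{R}^{(2m-1)}(\sigma)f(x)=\left(\frac{\sigma}{\pi}\right)^{2m-1}\sum_{k\in\mathbb{Z}}(-1)^{k+1}A_{m,k}\,f\!\left(e^{\frac{\pi}{\sigma}(k-1/2)}x\right),\qquad \mathcal{R}^{(2m)}(\sigma)f(x)=\left(\frac{\sigma}{\pi}\right)^{2m}\sum_{k\in\mathbb{Z}}(-1)^{k+1}B_{m,k}\,f\!\left(e^{\frac{\pi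 k}{\sigma}}x\right),$$ the sums being taken in $X^p(\mathbb{R}_+)$, where $$A_{m,k}=\frac{(2m-1)!}{\pi(k-\frac12)^{2m}}\sum_{j=0}^{m-1}\frac{(-1)^j}{(2j)!}\left(\pi(k-\tfrac12)\right)^{2j}\quad(k\in\mathbb{Z}),$$ $$B_{m,k}=\frac{(2m)!}{\pi k^{2m+1}}\sum_{j=0}^{m-1}\frac{(-1)^j(\pi k)^{2j+1}}{(2j+1)!}\quad(k\in\mathbb{Z}\setminus\{0\}),\qquad B_{m,0}=(-1)^{m+1}\frac{\pi^{2m}}{2m+1}.$$ **Statement.** Let $1<p<\infty$, $\sigma>0$ and $f\in\mathbf{B}^p_\sigma(\Theta)$. Then for all $\sigma_1\ge\sigma$, $\sigma_2\ge\sigma$ and every integer $r\ge1$ the series defining $\mathcal{R}^{(r)}(\sigma_1)f$ and $\mathcal{R}^{(r)}(\sigma_2)f$ converge unconditionally in $X^p(\mathbb{R}_+)$, and $$\mathcal{R}^{(r)}(\sigma_1)f=\mathcal{R}^{(r)}(\sigma_2)f .$$ -/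

import Mathlib

open MeasureTheory Set
open scoped ENNReal

noncomputable section

namespace Mellin11

/-- The measure `dx / x` on the half-line `(0, ∞)`, as a measure on `ℝ` carried by `(0, ∞)`. -/
def mellinMeasure : Measure ℝ :=
  (volume.restrict (Ioi 0)).withDensity fun x => ENNReal.ofReal x⁻¹

/-- The norm of `L^p(dx / x)` is the norm `‖x ^ (-1/p) f(x)‖_{L^p(0, ∞)}`. -/
theorem eLpNorm_mellinMeasure (p : ℝ≥0∞) (hp : 1 ≤ p) (hp' : p < ∞) (f : ℝ → ℂ) :
    eLpNorm f p mellinMeasure =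
      eLpNorm (fun x => f x * ((x ^ (-1 / p.toReal) : ℝ) : ℂ)) p (volume.restrict (Ioi 0)) := by
  have h0 : p ≠ 0 := (zero_lt_one.trans_le hp).ne'
  have hpos : 0 < p.toReal := ENNReal.toReal_pos h0 hp'.ne
  rw [eLpNorm_eq_lintegral_rpow_enorm_toReal h0 hp'.ne,
    eLpNorm_eq_lintegral_rpow_enorm_toReal h0 hp'.ne]
  congr 1
  unfold mellinMeasure
  rw [lintegral_withDensity_eq_lintegral_mul_non_measurable _
    (by fun_prop) (by simp)]
  refine setLIntegral_congr_fun measurableSet_Ioi fun x hx => ?_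
  have hx : 0 < x := hx
  simp only [Pi.mul_apply, enorm_mul, ENNReal.mul_rpow_of_nonneg _ _ hpos.le]
  rw [mul_comm]
  congr 1
  have h1 : ‖((x ^ (-1 / p.toReal) : ℝ) : ℂ)‖ₑ = ENNReal.ofReal (x ^ (-1 / p.toReal)) := by
    rw [← ofReal_norm, Complex.norm_real, Real.norm_of_nonneg (by positivity)]
  rw [h1, ENNReal.ofReal_rpow_of_nonneg (by positivity) hpos.le, ← Real.rpow_mul hx.le,
    div_mul_cancel₀ _ hpos.ne', Real.rpow_neg_one]

/-- The measure `dx / x` is invariant under the dilations `x ↦ e^t x`. -/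
theorem measurePreserving_dilation (t : ℝ) :
    MeasurePreserving (fun x : ℝ => Real.exp t * x) mellinMeasure mellinMeasure := by
  have hm : Measurable fun x : ℝ => Real.exp t * x := by fun_prop
  refine ⟨hm, ?_⟩
  ext s hs
  rw [Measure.map_apply hm hs]
  unfold mellinMeasure
  rw [withDensity_apply _ hs, withDensity_apply _ (hm hs), Measure.restrict_restrict hs,
    Measure.restrict_restrict (hm hs)]
  have hpos := Real.exp_pos t
  have himg : s ∩ Ioi 0 = (fun x : ℝ => Real.exp t * x) ''
      ((fun x : ℝ => Real.exp t * x) ⁻¹' s ∩ Ioi 0) := by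
    ext y
    constructor
    · rintro ⟨hy, hy0⟩
      have hy0 : 0 < y := hy0
      have hc : Real.exp t * ((Real.exp t)⁻¹ * y) = y := by field_simp
      exact ⟨(Real.exp t)⁻¹ * y, ⟨by simpa [hc] using hy, by simpa using (by positivity)⟩, hc⟩
    · rintro ⟨x, ⟨hx, hx0⟩, rfl⟩
      exact ⟨hx, mul_pos hpos hx0⟩
  rw [himg, lintegral_image_eq_lintegral_abs_deriv_mul ((hm hs).inter measurableSet_Ioi)
    (f' := fun _ => Real.exp t)
    (fun x _ => by simpa using ((hasDerivAt_id x).const_mul (Real.exp t)).hasDerivWithinAt)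
    (fun a _ b _ h => mul_left_cancel₀ hpos.ne' h)]
  refine setLIntegral_congr_fun ((hm hs).inter measurableSet_Ioi) fun x hx => ?_
  have hx : 0 < x := hx.2
  rw [abs_of_pos hpos, ← ENNReal.ofReal_mul hpos.le, mul_inv, mul_inv_cancel_left₀ hpos.ne']

/-- The Lebesgue-Mellin space `X^p`, that is `L^p((0, ∞), dx / x)`. -/
abbrev X (p : ℝ≥0∞) : Type := Lp ℂ p mellinMeasure

section

variable {p : ℝ≥0∞} [Fact (1 ≤ p)]

/-- The Mellin translation `(U(t) f)(x) = f(e^t x)`. -/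
def U (t : ℝ) (f : X p) : X p :=
  Lp.compMeasurePreserving (fun x : ℝ => Real.exp t * x) (measurePreserving_dilation t) f

/-- The domain of the infinitesimal generator of `U`: those `f` for which the difference quotient
`(U(t) f - f) / t` converges in `X^p` as `t → 0`. -/
def InDomain (f : X p) : Prop := DifferentiableAt ℝ (fun t : ℝ => U t f) 0

/-- The infinitesimal generator `Θ = x d/dx` of `U` (meaningful on the domain `InDomain`). -/
def Theta (f : X p) : X p := deriv (fun t : ℝ => U t f) 0

/-- The domain `D^k(Θ)` of the power `Θ^k`. -/
def domainPow (k : ℕ) : Set (X p) := {f | ∀ j < k, InDomain (Theta^[j] f)}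

/-- The set `D^∞(Θ) = ⋂ₖ D^k(Θ)`. -/
def domainInfty : Set (X p) := ⋂ k : ℕ, domainPow k

/-- The Bernstein space `B_σ^p(Θ)`. -/
def bernstein (p : ℝ≥0∞) [Fact (1 ≤ p)] (σ : ℝ) : Set (X p) :=
  {f | f ∈ domainInfty ∧ ∀ k : ℕ, ‖Theta^[k] f‖ ≤ σ ^ k * ‖f‖}

/-- The coefficients `A_{m,k}`. -/
def coeffA (m : ℕ) (k : ℤ) : ℝ :=
  ((2 * m - 1).factorial : ℝ) / (Real.pi * ((k : ℝ) - 1 / 2) ^ (2 * m)) *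
    ∑ j ∈ Finset.range m,
      (-1 : ℝ) ^ j / ((2 * j).factorial : ℝ) * (Real.pi * ((k : ℝ) - 1 / 2)) ^ (2 * j)

/-- The coefficients `B_{m,k}`. -/
def coeffB (m : ℕ) (k : ℤ) : ℝ :=
  if k = 0 then (-1 : ℝ) ^ (m + 1) * (Real.pi ^ (2 * m) / (2 * m + 1))
  else ((2 * m).factorial : ℝ) / (Real.pi * (k : ℝ) ^ (2 * m + 1)) *
    ∑ j ∈ Finset.range m,
      (-1 : ℝ) ^ j * (Real.pi * (k : ℝ)) ^ (2 * j + 1) / ((2 * j + 1).factorial : ℝ)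

/-- The `k`-th term of the series for `R^{(r)}(σ) f`; here `r = 2 m - 1` if `r` is odd and
`r = 2 m` if `r` is even. -/
def rieszBoasTerm (r : ℕ) (σ : ℝ) (f : X p) (k : ℤ) : X p :=
  if Odd r then
    ((σ / Real.pi) ^ r * ((-1 : ℝ) ^ (k + 1) * coeffA ((r + 1) / 2) k)) •
      U (Real.pi / σ * ((k : ℝ) - 1 / 2)) f
  else
    ((σ / Real.pi) ^ r * ((-1 : ℝ) ^ (k + 1) * coeffB (r / 2) k)) •
      U (Real.pi * (k : ℝ) / σ) f

/-- The Riesz-Boas operator `R^{(r)}(σ)`, the sum of its series in `X^p`. -/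
def rieszBoas (r : ℕ) (σ : ℝ) (f : X p) : X p := ∑' k : ℤ, rieszBoasTerm r σ f k

end

end Mellin11

end

/-! On the Bernstein space both sums equal `Θ^r f`, whatever the parameter `τ ≥ σ` (`rieszBoas_eq`).
It suffices to test this against each functional `φ`. The orbit `t ↦ φ(U(t) f)` has derivatives
`φ(U(t) Θ^n f)` bounded by `‖φ‖ ‖f‖ σ^n`, so it extends to an entire function of exponential type
`σ` (`exists_entire_extension`). Rescaled by `π/τ` it has type at most `π`, and the series becomes a
sampling formula for its `r`-th derivative at `0` (`hasSum_coeffA`, `hasSum_coeffB`).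

The sampling formulas rest on one fact: if `g` is entire of type `π` with quadratic decay, then `∑
(-1)^k g(k) = 0` (`hasSum_neg_one_zpow_mul_eq_zero`, by Poisson summation). It is applied to `(h T_e
- e T_h) / z^(n+2)`, corrected at the origin, where `e` is `sin πz` or `cos πz` and `T` denotes
Taylor polynomials: at the zeros of `e` other than `0` only `h T_e` survives, and `T_e` is the sum
inside the coefficients.

Convergence in `X^p` is absolute, since `U` is isometric and the coefficients are absolutely
summable. -/

/-! ### Contour shifts and alternating sums of entire functions of type `π`. -/

-- Cauchy's theorem on the rectangle over `[-R, R]`; the decay makes the vertical sides vanish as `R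
-- → ∞`.
open Filter Topology Complex in
theorem integral_eq_integral_add_mul_I {G : ℂ → ℂ} (hG : Differentiable ℂ G) {C y : ℝ}
    (hb : ∀ z : ℂ, |z.im| ≤ |y| → ‖G z‖ ≤ C / (1 + z.re ^ 2)) :
    ∫ x : ℝ, G x = ∫ x : ℝ, G (x + y * I) := by
  have hline (s : ℝ) (hs : |s| ≤ |y|) : Integrable (fun x : ℝ => G (x + s * I)) := by
    refine ((integrable_inv_one_add_sq.const_mul C).mono'
      ((hG.continuous.comp (by fun_prop)).aestronglyMeasurable) (.of_forall fun x => ?_))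
    simpa [div_eq_mul_inv] using hb (x + s * I) (by simpa using hs)
  have hside (R : ℝ) :
      ‖∫ s : ℝ in (0 : ℝ)..y, G (R + s * I)‖ ≤ C / (1 + R ^ 2) * |y - 0| := by
    refine intervalIntegral.norm_integral_le_of_norm_le_const fun s hs => ?_
    have : |s| ≤ |y| := by
      rcases le_total 0 y with h | h
      · rw [uIoc_of_le h] at hs
        rw [abs_of_pos hs.1, abs_of_nonneg h]; exact hs.2
      · rw [uIoc_of_ge h] at hs
        rw [abs_of_nonpos hs.2, abs_of_nonpos h]; linarith [hs.1]
    simpa using hb (R + s * I) (by simpa using this)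
  have hdecay : Tendsto (fun R : ℝ => C / (1 + R ^ 2) * |y - 0|) atTop (𝓝 0) := by
    have : Tendsto (fun R : ℝ => 1 + R ^ 2) atTop atTop :=
      tendsto_atTop_add_const_left _ _ (tendsto_pow_atTop two_ne_zero)
    simpa using (this.const_div_atTop C).mul_const |y - 0|
  have h1 : Tendsto (fun R : ℝ => ∫ s : ℝ in (0 : ℝ)..y, G (R + s * I)) atTop (𝓝 0) :=
    squeeze_zero_norm hside hdecay
  have h2 : Tendsto (fun R : ℝ => ∫ s : ℝ in (0 : ℝ)..y, G ((-R : ℝ) + s * I)) atTop (𝓝 0) :=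
    squeeze_zero_norm (fun R => by simpa using hside (-R)) hdecay
  have h3 := intervalIntegral_tendsto_integral (hline 0 (by simp)) tendsto_neg_atTop_atBot
    tendsto_id
  have h4 := intervalIntegral_tendsto_integral (hline y le_rfl) tendsto_neg_atTop_atBot
    tendsto_id
  have key (R : ℝ) : (∫ x : ℝ in (-R)..id R, G (x + (0 : ℝ) * I)) =
      (∫ x : ℝ in (-R)..id R, G (x + y * I)) -
      I • (∫ s : ℝ in (0 : ℝ)..y, G (R + s * I)) +
      I • (∫ s : ℝ in (0 : ℝ)..y, G ((-R : ℝ) + s * I)) := by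
    have := integral_boundary_rect_eq_zero_of_differentiableOn G ((-R : ℝ) : ℂ) (R + y * I)
      hG.differentiableOn
    simp only [ofReal_im, ofReal_re, add_re, mul_re, I_re, mul_zero, I_im, mul_one, sub_self,
      add_zero, add_im, mul_im, zero_add] at this
    simp only [id]
    linear_combination this
  have h5 := (h4.sub (h1.const_smul I)).add (h2.const_smul I)
  simp only [← key, smul_zero, sub_zero, add_zero] at h5
  simpa using tendsto_nhds_unique h3 h5

-- A Paley–Wiener statement, endpoints `|c| = π` included: the line of integration is pushed to
-- infinity on the side where the exponential decays.
open Filter Topology Complex in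
theorem integral_mul_exp_eq_zero {g : ℂ → ℂ} (hg : Differentiable ℂ g) {C : ℝ}
    (hb : ∀ z : ℂ, ‖g z‖ ≤ C * Real.exp (Real.pi * |z.im|) / (1 + ‖z‖ ^ 2))
    {c : ℝ} (hc : Real.pi ≤ |c|) : ∫ x : ℝ, g x * exp (I * c * x) = 0 := by
  have hC : 0 ≤ C := by
    have := (norm_nonneg _).trans (hb 0)
    simpa using this
  set G : ℂ → ℂ := fun z => g z * exp (I * c * z) with hGdef
  have hG : Differentiable ℂ G := by fun_prop
  have hGn (z : ℂ) : ‖G z‖ ≤ C * Real.exp (Real.pi * |z.im| - c * z.im) / (1 + ‖z‖ ^ 2) := by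
    rw [hGdef, norm_mul, norm_exp]
    refine (mul_le_mul_of_nonneg_right (hb z) (Real.exp_pos _).le).trans_eq ?_
    rw [sub_eq_add_neg, Real.exp_add]
    simp
    ring
  obtain ⟨e, he, hce⟩ : ∃ e : ℝ, |e| = 1 ∧ c * e = |c| := by
    rcases le_total 0 c with h | h
    · exact ⟨1, by simp, by simp [abs_of_nonneg h]⟩
    · exact ⟨-1, by simp, by simp [abs_of_nonpos h]⟩
  have hshift (n : ℕ) : ∫ x : ℝ, G x = ∫ x : ℝ, G (x + (e * n : ℝ) * I) := by
    refine integral_eq_integral_add_mul_I hG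
      (C := C * Real.exp (Real.pi * n + |c| * n)) fun z hz => (hGn z).trans ?_
    have hz : |z.im| ≤ n := by simpa [abs_mul, he] using hz
    refine div_le_div₀ (by positivity) ?_ (by positivity) (add_le_add_right ?_ 1)
    · refine mul_le_mul_of_nonneg_left (Real.exp_le_exp.2 ?_) hC
      rw [sub_eq_add_neg]
      gcongr
      rw [← neg_mul]
      refine (le_abs_self _).trans ?_
      rw [abs_mul, abs_neg]
      gcongr
    · exact sq_le_sq.2 (by simpa using abs_re_le_norm z)
  -- The exponent is `(π - |c|) n ≤ 0`. When `|c| = π` the exponential gives no decay, and the `n ^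
  -- 2` in the denominator does the work.
  have hbound (n : ℕ) (x : ℝ) : ‖G (x + (e * n : ℝ) * I)‖ ≤ C / (1 + x ^ 2 + n ^ 2) := by
    refine (hGn _).trans ?_
    have hn : ‖(x + (e * n : ℝ) * I : ℂ)‖ ^ 2 = x ^ 2 + n ^ 2 := by
      rw [← normSq_eq_norm_sq, normSq_add_mul_I, mul_pow, ← sq_abs e, he]; simp
    have him : (x + (e * n : ℝ) * I : ℂ).im = e * n := by simp
    rw [hn, him, abs_mul, he, ← mul_assoc c, hce, add_assoc]
    gcongr
    refine mul_le_of_le_one_right hC (Real.exp_le_one_iff.2 ?_)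
    simp only [one_mul, Nat.abs_cast]
    nlinarith [n.cast_nonneg (α := ℝ)]
  have hlim : Tendsto (fun n : ℕ => ∫ x : ℝ, G (x + (e * n : ℝ) * I)) atTop
      (𝓝 (∫ _ : ℝ, (0 : ℂ))) := by
    refine tendsto_integral_of_dominated_convergence (fun x => C * (1 + x ^ 2)⁻¹)
      (fun n => (hG.continuous.comp (by fun_prop)).aestronglyMeasurable)
      (integrable_inv_one_add_sq.const_mul C) (fun n => .of_forall fun x => ?_)
      (.of_forall fun x => ?_)
    · refine (hbound n x).trans ?_
      rw [div_eq_mul_inv]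
      exact mul_le_mul_of_nonneg_left (inv_anti₀ (by positivity) (by nlinarith)) hC
    · refine squeeze_zero_norm (hbound · x) ?_
      have : Tendsto (fun n : ℕ => 1 + x ^ 2 + (n : ℝ) ^ 2) atTop atTop :=
        tendsto_atTop_add_const_left _ _
          ((tendsto_pow_atTop two_ne_zero).comp tendsto_natCast_atTop_atTop)
      exact this.const_div_atTop C
  simp only [← hshift, integral_zero] at hlim
  exact tendsto_nhds_unique tendsto_const_nhds hlim

theorem Complex.exp_I_pi_int (k : ℤ) : Complex.exp (Complex.I * Real.pi * k) = (-1) ^ k := by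
  rw [← Complex.exp_pi_mul_I, ← Complex.exp_int_mul]; ring_nf

-- Since `(-1)^k = e^{iπk}`, this is a sum over the integers of `g(x) e^{iπx}`. Its Fourier
-- transform at an integer is an integral with frequency an odd multiple of `π`, hence zero, and
-- Poisson summation concludes.
open Filter Topology Complex in
theorem hasSum_neg_one_zpow_mul_eq_zero {g : ℂ → ℂ} (hg : Differentiable ℂ g) {C : ℝ}
    (hb : ∀ z : ℂ, ‖g z‖ ≤ C * Real.exp (Real.pi * |z.im|) / (1 + ‖z‖ ^ 2)) :
    HasSum (fun k : ℤ => (-1 : ℂ) ^ k * g k) 0 := by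
  have hC : 0 ≤ C := by
    have := (norm_nonneg _).trans (hb 0)
    simpa using this
  set f : ℝ → ℂ := fun x => g x * exp (I * Real.pi * x) with hf
  have hcont : Continuous f := by have := hg.continuous; fun_prop
  have hO : f =O[cocompact ℝ] (fun x : ℝ => |x| ^ (-2 : ℝ)) := by
    refine Asymptotics.IsBigO.of_bound C ?_
    filter_upwards [(isCompact_singleton (x := (0 : ℝ))).compl_mem_cocompact] with x hx
    have hx : x ≠ 0 := hx
    have h1 : ‖f x‖ = ‖g x‖ := by
      rw [hf, norm_mul, mul_assoc, mul_comm I, ← ofReal_mul, norm_exp_ofReal_mul_I, mul_one]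
    rw [h1, Real.rpow_neg (abs_nonneg x), Real.norm_of_nonneg (by positivity)]
    refine (hb x).trans ?_
    rw [div_eq_mul_inv]
    simp only [ofReal_im, abs_zero, mul_zero, Real.exp_zero, mul_one, norm_real, Real.norm_eq_abs,
      sq_abs, Real.rpow_ofNat]
    gcongr
    linarith
  have hF (n : ℤ) : FourierTransform.fourier f (n : ℝ) = 0 := by
    rw [Real.fourier_real_eq_integral_exp_smul]
    have hc : Real.pi ≤ |Real.pi * (1 - 2 * n)| := by
      rw [abs_mul, abs_of_pos Real.pi_pos]
      refine le_mul_of_one_le_right Real.pi_pos.le ?_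
      have : (1 : ℤ) ≤ |1 - 2 * n| := Int.one_le_abs (by omega)
      exact_mod_cast this
    rw [← integral_mul_exp_eq_zero hg hb hc]
    congr 1 with x
    rw [smul_eq_mul, hf, mul_left_comm, ← exp_add]
    congr 2
    push_cast
    ring
  have hsum : Summable fun k : ℤ => f k :=
    summable_of_isBigO (Real.summable_abs_int_rpow one_lt_two)
      (hO.comp_tendsto Int.tendsto_coe_cofinite)
  have := Real.tsum_eq_tsum_fourier_of_rpow_decay_of_summable hcont one_lt_two hO
    (by simpa only [hF] using summable_zero) 0
  simp only [zero_add, hF, zero_mul, tsum_zero] at this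
  have h := hsum.hasSum
  rw [this] at h
  convert h using 2 with k
  rw [hf]
  push_cast
  rw [exp_I_pi_int, mul_comm]

/-! ### Growth of sine and cosine, Taylor polynomials and remainders at `0`. -/

theorem Complex.norm_sin_le_exp_abs_im (z : ℂ) : ‖Complex.sin z‖ ≤ Real.exp |z.im| := by
  rw [Complex.sin, norm_div, norm_mul, Complex.norm_I, mul_one, Complex.norm_ofNat]
  have h := norm_sub_le (Complex.exp (-z * Complex.I)) (Complex.exp (z * Complex.I))
  have h1 := Real.exp_le_exp.2 (le_abs_self z.im)
  have h2 := Real.exp_le_exp.2 (neg_abs_le z.im)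
  have h3 := Real.exp_le_exp.2 (neg_le_abs z.im)
  simp only [Complex.norm_exp, Complex.mul_re, Complex.I_re, Complex.I_im, Complex.neg_re,
    Complex.neg_im, mul_zero, mul_one, zero_sub, neg_neg] at h
  linarith

theorem Complex.norm_cos_le_exp_abs_im (z : ℂ) : ‖Complex.cos z‖ ≤ Real.exp |z.im| := by
  rw [Complex.cos, norm_div, Complex.norm_ofNat]
  have h := norm_add_le (Complex.exp (z * Complex.I)) (Complex.exp (-z * Complex.I))
  have h1 := Real.exp_le_exp.2 (le_abs_self z.im)
  have h3 := Real.exp_le_exp.2 (neg_le_abs z.im)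
  simp only [Complex.norm_exp, Complex.mul_re, Complex.I_re, Complex.I_im, Complex.neg_re,
    Complex.neg_im, mul_zero, mul_one, zero_sub, neg_neg] at h
  linarith

/-- The `n`-th Taylor coefficient at `0`. -/
noncomputable def taylorCoef (h : ℂ → ℂ) (n : ℕ) : ℂ := iteratedDeriv n h 0 / n.factorial

/-- The sum of the first `n` terms of the Taylor series at `0`. -/
noncomputable def taylorSum (h : ℂ → ℂ) (n : ℕ) (z : ℂ) : ℂ :=
  ∑ j ∈ Finset.range n, taylorCoef h j * z ^ j

/-- The remainder of `taylorSum h n`, divided by `z ^ n`. -/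
noncomputable def taylorQuot (h : ℂ → ℂ) (n : ℕ) : ℂ → ℂ := (Function.swap dslope 0)^[n] h

theorem taylorQuot_succ (h : ℂ → ℂ) (n : ℕ) :
    taylorQuot h (n + 1) = dslope (taylorQuot h n) 0 :=
  Function.iterate_succ_apply' _ _ _

theorem Differentiable.dslope {h : ℂ → ℂ} (hh : Differentiable ℂ h) (c : ℂ) :
    Differentiable ℂ (dslope h c) := by
  rw [← differentiableOn_univ]
  exact (Complex.differentiableOn_dslope Filter.univ_mem).2 hh.differentiableOn

theorem Differentiable.taylorQuot {h : ℂ → ℂ} (hh : Differentiable ℂ h) (n : ℕ) :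
    Differentiable ℂ (taylorQuot h n) := by
  induction n with
  | zero => exact hh
  | succ n ih => rw [taylorQuot_succ]; exact ih.dslope 0

theorem taylorQuot_zero_right {h : ℂ → ℂ} (hh : Differentiable ℂ h) (n : ℕ) :
    taylorQuot h n 0 = taylorCoef h n := by
  have h1 := (hh.analyticAt 0).hasFPowerSeriesAt.has_fpower_series_iterate_dslope_fslope n
  have h2 := h1.coeff_zero 1
  rw [taylorQuot, ← h2]
  change ((FormalMultilinearSeries.fslope^[n]) _).coeff 0 = _
  simp [FormalMultilinearSeries.coeff_iterate_fslope, FormalMultilinearSeries.coeff_ofScalars,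
    taylorCoef]

theorem deriv_taylorQuot_zero {h : ℂ → ℂ} (hh : Differentiable ℂ h) (n : ℕ) :
    deriv (taylorQuot h n) 0 = taylorCoef h (n + 1) := by
  rw [← taylorQuot_zero_right hh, taylorQuot_succ, dslope_same]

theorem taylorSum_add_pow_mul_taylorQuot {h : ℂ → ℂ} (hh : Differentiable ℂ h) (n : ℕ) (z : ℂ) :
    taylorSum h n z + z ^ n * taylorQuot h n z = h z := by
  induction n with
  | zero => simp [taylorSum, taylorQuot]
  | succ n ih =>
    have h1 := sub_smul_dslope (taylorQuot h n) 0 z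
    rw [sub_zero, smul_eq_mul, taylorQuot_zero_right hh, ← taylorQuot_succ] at h1
    rw [← ih, taylorSum, taylorSum, Finset.sum_range_succ]
    linear_combination z ^ n * h1

/-- Outside the unit disc every power is dominated by the top one. -/
theorem norm_taylorSum_le (h : ℂ → ℂ) (n : ℕ) {z : ℂ} (hz : 1 ≤ ‖z‖) :
    ‖taylorSum h (n + 1) z‖ ≤ (∑ j ∈ Finset.range (n + 1), ‖taylorCoef h j‖) * ‖z‖ ^ n := by
  rw [Finset.sum_mul]
  refine norm_sum_le_of_le _ fun j hj => ?_
  rw [norm_mul, norm_pow]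
  gcongr
  exact Nat.lt_succ_iff.1 (Finset.mem_range.1 hj)

/-! ### The interpolation quotient. -/

theorem exists_bound_of_bound_of_one_le_norm {g : ℂ → ℂ} (hg : Continuous g) {C : ℝ}
    (hb : ∀ z : ℂ, 1 ≤ ‖z‖ → ‖g z‖ ≤ C * Real.exp (Real.pi * |z.im|) / ‖z‖ ^ 2) :
    ∃ C', ∀ z : ℂ, ‖g z‖ ≤ C' * Real.exp (Real.pi * |z.im|) / (1 + ‖z‖ ^ 2) := by
  obtain ⟨K, hK⟩ := (isCompact_closedBall (0 : ℂ) 1).exists_bound_of_continuousOn hg.continuousOn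
  have hC : 0 ≤ C := by
    have := (norm_nonneg _).trans (hb 1 (by simp))
    simpa using this
  have hK0 : 0 ≤ K := (norm_nonneg _).trans (hK 0 (by simp))
  refine ⟨2 * (C + K), fun z => ?_⟩
  have he : 1 ≤ Real.exp (Real.pi * |z.im|) := Real.one_le_exp (by positivity)
  rw [le_div_iff₀ (by positivity)]
  rcases le_total 1 ‖z‖ with h | h
  · have h1 := hb z h
    have h2 : (1 : ℝ) ≤ ‖z‖ ^ 2 := one_le_pow₀ h
    rw [le_div_iff₀ (by positivity)] at h1
    have h3 : 0 ≤ K * Real.exp (Real.pi * |z.im|) := by positivity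
    nlinarith [norm_nonneg (g z)]
  · have h1 := hK z (by simpa using h)
    have h2 : ‖z‖ ^ 2 ≤ 1 := pow_le_one₀ (norm_nonneg _) h
    have h3 : 0 ≤ C * Real.exp (Real.pi * |z.im|) := by positivity
    calc ‖g z‖ * (1 + ‖z‖ ^ 2) ≤ K * 2 := by gcongr; linarith
      _ ≤ K * 2 * Real.exp (Real.pi * |z.im|) := le_mul_of_one_le_right (by positivity) he
      _ ≤ _ := by linarith

/-- A real shift leaves `Im z` unchanged and changes `1 + ‖z‖ ^ 2` by at most a constant factor; it
moves the half-integer nodes to the integers. -/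
theorem exists_bound_comp_sub {g : ℂ → ℂ} {C : ℝ} (a : ℝ)
    (hb : ∀ z : ℂ, ‖g z‖ ≤ C * Real.exp (Real.pi * |z.im|) / (1 + ‖z‖ ^ 2)) :
    ∃ C', ∀ z : ℂ, ‖g (z - a)‖ ≤ C' * Real.exp (Real.pi * |z.im|) / (1 + ‖z‖ ^ 2) := by
  have hC : 0 ≤ C := by
    have := (norm_nonneg _).trans (hb 0)
    simpa using this
  refine ⟨C * (2 + 2 * a ^ 2), fun z => (hb _).trans ?_⟩
  have h1 : ‖z‖ ≤ ‖z - a‖ + |a| := by simpa using norm_add_le (z - a) (a : ℂ)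
  have h2 : ‖z‖ ^ 2 ≤ 2 * ‖z - a‖ ^ 2 + 2 * a ^ 2 := by
    rw [← sq_abs a]
    nlinarith [sq_nonneg (‖z - a‖ - |a|), norm_nonneg z]
  rw [div_le_div_iff₀ (by positivity) (by positivity), Complex.sub_im, Complex.ofReal_im, sub_zero]
  have : 0 ≤ C * Real.exp (Real.pi * |z.im|) := by positivity
  calc _ ≤ C * Real.exp (Real.pi * |z.im|) * ((2 + 2 * a ^ 2) * (1 + ‖z - a‖ ^ 2)) := by
        gcongr
        nlinarith [sq_nonneg a, sq_nonneg ‖z - a‖, mul_nonneg (sq_nonneg a) (sq_nonneg ‖z - a‖)]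
    _ = _ := by ring

/-- Dividing `h T_e - e T_h` by `z^(n+1)` leaves an entire function with value `w₀` at `0`.
Subtracting `w₀ sin(πz)/(πz)` cancels that value without raising the type, so one more division by
`z` is possible. The Taylor polynomials have degree at most `n`, which leaves quadratic decay. -/
theorem exists_interpolation_quotient {h e : ℂ → ℂ} (hh : Differentiable ℂ h)
    (he : Differentiable ℂ e) {Ch Ce : ℝ}
    (hhb : ∀ z : ℂ, ‖h z‖ ≤ Ch * Real.exp (Real.pi * |z.im|))
    (heb : ∀ z : ℂ, ‖e z‖ ≤ Ce * Real.exp (Real.pi * |z.im|)) (n : ℕ) {w₀ : ℂ}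
    (hw₀ : w₀ = e 0 * taylorCoef h (n + 1) - h 0 * taylorCoef e (n + 1)) :
    ∃ g : ℂ → ℂ, Differentiable ℂ g ∧
      (∃ C, ∀ z : ℂ, ‖g z‖ ≤ C * Real.exp (Real.pi * |z.im|) / (1 + ‖z‖ ^ 2)) ∧
      (∀ z ≠ 0, g z = (h z * taylorSum e (n + 1) z - e z * taylorSum h (n + 1) z) / z ^ (n + 2)
        - w₀ * Complex.sin (Real.pi * z) / (Real.pi * z ^ 2)) ∧
      (w₀ = 0 → g 0 = e 0 * taylorCoef h (n + 2) + deriv e 0 * taylorCoef h (n + 1)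
        - h 0 * taylorCoef e (n + 2) - deriv h 0 * taylorCoef e (n + 1)) := by
  have hpi : (Real.pi : ℂ) ≠ 0 := Complex.ofReal_ne_zero.2 Real.pi_ne_zero
  set s : ℂ → ℂ := fun z => Complex.sin (Real.pi * z) / Real.pi with hs
  have hsd : Differentiable ℂ s := by fun_prop
  have hs' : deriv s 0 = 1 := by
    have : HasDerivAt s (Complex.cos (Real.pi * 0) * (Real.pi * 1) / Real.pi) 0 :=
      (((hasDerivAt_id (0 : ℂ)).const_mul (Real.pi : ℂ)).csin).div_const _
    rw [this.deriv]
    simp [hpi]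
  -- Writing each function as Taylor polynomial plus `z^(n+1)` times quotient, the products `h e`
  -- cancel; hence `w` is `(h T_e - e T_h) / z^(n+1)`, visibly entire.
  set w : ℂ → ℂ := fun z => e z * taylorQuot h (n + 1) z - h z * taylorQuot e (n + 1) z with hw
  have hwd : Differentiable ℂ w :=
    (he.mul (hh.taylorQuot _)).sub (hh.mul (he.taylorQuot _))
  have hw0 : w 0 = w₀ := by
    rw [hw₀, hw]
    simp only [taylorQuot_zero_right hh, taylorQuot_zero_right he]
  have hwz (z : ℂ) : z ^ (n + 1) * w z =
      h z * taylorSum e (n + 1) z - e z * taylorSum h (n + 1) z := by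
    have h1 := taylorSum_add_pow_mul_taylorQuot hh (n + 1) z
    have h2 := taylorSum_add_pow_mul_taylorQuot he (n + 1) z
    rw [hw]
    linear_combination e z * h1 - h z * h2
  set v : ℂ → ℂ := fun z => w z - w₀ * dslope s 0 z with hv
  have hvd : Differentiable ℂ v := hwd.sub ((hsd.dslope 0).const_mul _)
  have hv0 : v 0 = 0 := by simp [hv, hw0, hs']
  have hsz {z : ℂ} (hz : z ≠ 0) : dslope s 0 z = Complex.sin (Real.pi * z) / (Real.pi * z) := by
    rw [dslope_of_ne _ hz, slope_def_field, hs]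
    simp [div_div]
  have hgz (z : ℂ) (hz : z ≠ 0) :
      dslope v 0 z = (h z * taylorSum e (n + 1) z - e z * taylorSum h (n + 1) z) / z ^ (n + 2)
        - w₀ * Complex.sin (Real.pi * z) / (Real.pi * z ^ 2) := by
    rw [← hwz, dslope_of_ne _ hz, slope_def_field, hv0, hv]
    simp only [hsz hz]
    field_simp
    ring
  refine ⟨dslope v 0, hvd.dslope 0, ?_, hgz, fun h0 => ?_⟩
  · refine exists_bound_of_bound_of_one_le_norm (hvd.dslope 0).continuous
      (C := Ch * (∑ j ∈ Finset.range (n + 1), ‖taylorCoef e j‖) +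
        Ce * (∑ j ∈ Finset.range (n + 1), ‖taylorCoef h j‖) + ‖w₀‖ / Real.pi) fun z hz => ?_
    have hz0 : z ≠ 0 := norm_pos_iff.1 (by linarith)
    have hz1 : 0 < ‖z‖ := by linarith
    rw [hgz z hz0]
    have hsb : ‖Complex.sin (Real.pi * z)‖ ≤ Real.exp (Real.pi * |z.im|) := by
      simpa [abs_mul, abs_of_pos Real.pi_pos] using Complex.norm_sin_le_exp_abs_im (Real.pi * z)
    have hChe : 0 ≤ Ch * Real.exp (Real.pi * |z.im|) := (norm_nonneg _).trans (hhb z)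
    have hCee : 0 ≤ Ce * Real.exp (Real.pi * |z.im|) := (norm_nonneg _).trans (heb z)
    have b1 := mul_le_mul (hhb z) (norm_taylorSum_le e n hz) (norm_nonneg _) hChe
    have b2 := mul_le_mul (heb z) (norm_taylorSum_le h n hz) (norm_nonneg _) hCee
    rw [← norm_mul] at b1 b2
    have b3 := (norm_sub_le (h z * taylorSum e (n + 1) z) (e z * taylorSum h (n + 1) z)).trans
      (add_le_add b1 b2)
    refine (norm_sub_le _ _).trans ?_
    rw [norm_div, norm_div, norm_mul w₀, norm_mul (Real.pi : ℂ), norm_pow, norm_pow,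
      Complex.norm_real, Real.norm_of_nonneg Real.pi_pos.le]
    have b4 : ‖w₀‖ * ‖Complex.sin (Real.pi * z)‖ / (Real.pi * ‖z‖ ^ 2) ≤
        ‖w₀‖ * Real.exp (Real.pi * |z.im|) / (Real.pi * ‖z‖ ^ 2) := by gcongr
    refine (add_le_add (div_le_div_of_nonneg_right b3 (by positivity)) b4).trans_eq ?_
    have := Real.pi_pos
    field_simp
    ring
  · have h1 : HasDerivAt w (deriv e 0 * taylorCoef h (n + 1) + e 0 * taylorCoef h (n + 2)
        - (deriv h 0 * taylorCoef e (n + 1) + h 0 * taylorCoef e (n + 2))) 0 := by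
      have := ((he 0).hasDerivAt.mul ((hh.taylorQuot (n + 1)) 0).hasDerivAt).sub
        ((hh 0).hasDerivAt.mul ((he.taylorQuot (n + 1)) 0).hasDerivAt)
      simp only [taylorQuot_zero_right hh, taylorQuot_zero_right he, deriv_taylorQuot_zero hh,
        deriv_taylorQuot_zero he] at this
      exact this
    have h2 : v = w := by ext z; simp [hv, h0]
    rw [dslope_same, h2, h1.deriv]
    ring

/-! ### Taylor data of `sin πz` and `cos πz`, and a sum over half-integers. -/

theorem taylorCoef_sin_pi_even (n : ℕ) :
    taylorCoef (fun z => Complex.sin (Real.pi * z)) (2 * n) = 0 := by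
  rw [taylorCoef, iteratedDeriv_comp_const_mul Complex.contDiff_sin]
  simp

theorem taylorCoef_sin_pi_odd (n : ℕ) :
    taylorCoef (fun z => Complex.sin (Real.pi * z)) (2 * n + 1) =
      (-1) ^ n * (Real.pi : ℂ) ^ (2 * n + 1) / (2 * n + 1).factorial := by
  rw [taylorCoef, iteratedDeriv_comp_const_mul Complex.contDiff_sin,
    Complex.iteratedDeriv_odd_sin]
  simp
  ring

theorem taylorCoef_cos_pi_even (n : ℕ) :
    taylorCoef (fun z => Complex.cos (Real.pi * z)) (2 * n) =
      (-1) ^ n * (Real.pi : ℂ) ^ (2 * n) / (2 * n).factorial := by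
  rw [taylorCoef, iteratedDeriv_comp_const_mul Complex.contDiff_cos,
    Complex.iteratedDeriv_even_cos]
  simp
  ring

theorem taylorCoef_cos_pi_odd (n : ℕ) :
    taylorCoef (fun z => Complex.cos (Real.pi * z)) (2 * n + 1) = 0 := by
  rw [taylorCoef, iteratedDeriv_comp_const_mul Complex.contDiff_cos]
  simp

theorem taylorSum_sin_pi (m : ℕ) (z : ℂ) :
    taylorSum (fun z => Complex.sin (Real.pi * z)) (2 * m) z =
      ∑ j ∈ Finset.range m,
        (-1 : ℂ) ^ j * (Real.pi * z) ^ (2 * j + 1) / ((2 * j + 1).factorial : ℂ) := by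
  induction m with
  | zero => simp [taylorSum]
  | succ m ih =>
    rw [Finset.sum_range_succ, ← ih, taylorSum, mul_add, mul_one, Finset.sum_range_succ,
      Finset.sum_range_succ, taylorCoef_sin_pi_even, taylorCoef_sin_pi_odd, taylorSum]
    ring

theorem taylorSum_cos_pi (m : ℕ) (z : ℂ) :
    taylorSum (fun z => Complex.cos (Real.pi * z)) (2 * m + 1) z =
      ∑ j ∈ Finset.range (m + 1),
        (-1 : ℂ) ^ j / ((2 * j).factorial : ℂ) * (Real.pi * z) ^ (2 * j) := by
  induction m with
  | zero => simp [taylorSum, taylorCoef]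
  | succ m ih =>
    rw [Finset.sum_range_succ, ← ih, taylorSum, Finset.sum_range_succ,
      show 2 * (m + 1) = 2 * m + 1 + 1 by ring, Finset.sum_range_succ,
      taylorCoef_cos_pi_odd, show 2 * m + 1 + 1 = 2 * (m + 1) by ring, taylorCoef_cos_pi_even,
      taylorSum]
    ring

/-- Removing the even terms from `ζ(2) = π²/6` leaves `π²/8` for the odd ones; rescaling by `4` and
counting both signs gives `π²`. -/
theorem hasSum_one_div_int_sub_half_sq :
    HasSum (fun k : ℤ => 1 / ((k : ℝ) - 1 / 2) ^ 2) (Real.pi ^ 2) := by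
  have hz := hasSum_zeta_two
  have hsum : Summable fun n : ℕ => (1 : ℝ) / ((2 * n + 1 : ℕ) : ℝ) ^ 2 :=
    hz.summable.comp_injective (i := fun n : ℕ => 2 * n + 1) fun a b h => by
      simpa using h
  have heven : HasSum (fun n : ℕ => (1 : ℝ) / ((2 * n : ℕ) : ℝ) ^ 2) (1 / 4 * (Real.pi ^ 2 / 6)) := by
    refine (hz.mul_left (1 / 4 : ℝ)).congr_fun fun n => ?_
    push_cast
    rw [mul_pow]
    ring
  have hodd : HasSum (fun n : ℕ => (1 : ℝ) / ((2 * n + 1 : ℕ) : ℝ) ^ 2) (Real.pi ^ 2 / 8) := by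
    have h1 := (HasSum.even_add_odd (f := fun n : ℕ => (1 : ℝ) / (n : ℝ) ^ 2) heven hsum.hasSum).unique hz
    have h2 : ∑' n : ℕ, (1 : ℝ) / ((2 * n + 1 : ℕ) : ℝ) ^ 2 = Real.pi ^ 2 / 8 := by linarith
    exact hsum.hasSum_iff.2 h2
  have hhalf : HasSum (fun n : ℕ => (1 : ℝ) / ((n : ℝ) + 1 / 2) ^ 2) (Real.pi ^ 2 / 2) := by
    have h1 := hodd.mul_left 4
    rw [show 4 * (Real.pi ^ 2 / 8) = Real.pi ^ 2 / 2 by ring] at h1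
    refine h1.congr_fun fun n => ?_
    push_cast
    field_simp
    ring
  have hint : HasSum (fun k : ℤ => 1 / ((k : ℝ) + 1 / 2) ^ 2) (Real.pi ^ 2) := by
    have h1 : HasSum (fun n : ℕ => 1 / (((-((n : ℤ) + 1) : ℤ) : ℝ) + 1 / 2) ^ 2)
        (Real.pi ^ 2 / 2) := by
      refine hhalf.congr_fun fun n => ?_
      push_cast
      ring
    have := HasSum.of_nat_of_neg_add_one (f := fun k : ℤ => 1 / ((k : ℝ) + 1 / 2) ^ 2)
      (by simpa using hhalf) h1
    rwa [add_halves] at this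
  rw [← (Equiv.addRight (1 : ℤ)).hasSum_iff]
  refine hint.congr_fun fun k => ?_
  simp only [Function.comp_apply, Equiv.coe_addRight]
  push_cast
  ring

/-! ### Sampling formulas for derivatives at `0`. -/

theorem norm_sin_pi_mul_le (z : ℂ) :
    ‖Complex.sin (Real.pi * z)‖ ≤ 1 * Real.exp (Real.pi * |z.im|) := by
  simpa [abs_mul, abs_of_pos Real.pi_pos] using Complex.norm_sin_le_exp_abs_im (Real.pi * z)

theorem norm_cos_pi_mul_le (z : ℂ) :
    ‖Complex.cos (Real.pi * z)‖ ≤ 1 * Real.exp (Real.pi * |z.im|) := by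
  simpa [abs_mul, abs_of_pos Real.pi_pos] using Complex.norm_cos_le_exp_abs_im (Real.pi * z)

/-- Interpolation with `e = sin πz`, whose zeros are the integers. The node `0` is also the point of
expansion: `g 0` contains both the derivative sought and the exceptional coefficient `B_{m,0}`. -/
theorem hasSum_coeffB {h : ℂ → ℂ} (hh : Differentiable ℂ h) {C : ℝ}
    (hb : ∀ z : ℂ, ‖h z‖ ≤ C * Real.exp (Real.pi * |z.im|)) {m : ℕ} (hm : m ≠ 0) :
    HasSum (fun k : ℤ => (-1 : ℂ) ^ (k + 1) * (Mellin11.coeffB m k : ℂ) * h k)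
      (iteratedDeriv (2 * m) h 0) := by
  have hpi : (Real.pi : ℂ) ≠ 0 := Complex.ofReal_ne_zero.2 Real.pi_ne_zero
  obtain ⟨M, hM⟩ := Nat.exists_eq_add_one_of_ne_zero hm
  obtain ⟨g, hgd, ⟨D, hgb⟩, hg, hg0⟩ := exists_interpolation_quotient hh
    (e := fun z => Complex.sin (Real.pi * z)) (by fun_prop) hb norm_sin_pi_mul_le (2 * M + 1)
    (w₀ := 0) (by
      rw [show 2 * M + 1 + 1 = 2 * m by omega, taylorCoef_sin_pi_even]
      simp)
  have hsum := hasSum_neg_one_zpow_mul_eq_zero hgd hgb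
  have hfac : ((2 * m).factorial : ℂ) ≠ 0 := by exact_mod_cast (2 * m).factorial_ne_zero
  have hfac' : (2 * (m : ℂ) + 1) ≠ 0 := by exact_mod_cast (2 * m).succ_ne_zero
  have hderiv : deriv (fun z : ℂ => Complex.sin (Real.pi * z)) 0 = Real.pi := by
    have : HasDerivAt (fun z : ℂ => Complex.sin (Real.pi * z))
        (Complex.cos (Real.pi * 0) * (Real.pi * 1)) 0 :=
      ((hasDerivAt_id (0 : ℂ)).const_mul (Real.pi : ℂ)).csin
    rw [this.deriv]
    simp
  have hg0' : g 0 = Real.pi * taylorCoef h (2 * m) -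
      h 0 * ((-1) ^ m * (Real.pi : ℂ) ^ (2 * m + 1) / (2 * m + 1).factorial) := by
    rw [hg0 rfl, hderiv, show 2 * M + 1 + 2 = 2 * m + 1 by omega,
      show 2 * M + 1 + 1 = 2 * m by omega, taylorCoef_sin_pi_even, taylorCoef_sin_pi_odd]
    simp
  -- The point mass at `k = 0` cancels the derivative term of `g 0`, so it reappears as the total.
  have h1 := (hsum.mul_left (-((2 * m).factorial / (Real.pi : ℂ)))).add
    (hasSum_ite_eq (0 : ℤ) ((2 * m).factorial * taylorCoef h (2 * m)))
  rw [mul_zero, zero_add, taylorCoef, mul_div_cancel₀ _ hfac] at h1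
  refine h1.congr_fun fun k => ?_
  rw [zpow_add₀ (by norm_num), zpow_one]
  by_cases hk : k = 0
  · subst hk
    simp only [Int.cast_zero, hg0', Mellin11.coeffB, if_true, Nat.factorial_succ, taylorCoef]
    push_cast
    field_simp
    ring
  · have hk' : (k : ℂ) ≠ 0 := Int.cast_ne_zero.2 hk
    have hs : Complex.sin (Real.pi * k) = 0 := by rw [mul_comm]; exact Complex.sin_int_mul_pi k
    rw [hg k hk', hs, show 2 * M + 1 + 1 = 2 * m by omega, taylorSum_sin_pi,
      show 2 * M + 1 + 2 = 2 * m + 1 by omega, if_neg hk, Mellin11.coeffB, if_neg hk]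
    push_cast
    ring

/-- Interpolation with `e = cos πz`, whose zeros are the half-integers. Here `w₀` is the Taylor
coefficient sought, and it is recovered by summing the sine correction over the nodes. -/
theorem hasSum_coeffA {h : ℂ → ℂ} (hh : Differentiable ℂ h) {C : ℝ}
    (hb : ∀ z : ℂ, ‖h z‖ ≤ C * Real.exp (Real.pi * |z.im|)) {m : ℕ} (hm : m ≠ 0) :
    HasSum (fun k : ℤ => (-1 : ℂ) ^ (k + 1) * (Mellin11.coeffA m k : ℂ) * h (k - 1 / 2))
      (iteratedDeriv (2 * m - 1) h 0) := by
  have hpi : (Real.pi : ℂ) ≠ 0 := Complex.ofReal_ne_zero.2 Real.pi_ne_zero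
  obtain ⟨M, hM⟩ := Nat.exists_eq_add_one_of_ne_zero hm
  obtain ⟨g, hgd, ⟨D, hgb⟩, hg, -⟩ := exists_interpolation_quotient hh
    (e := fun z => Complex.cos (Real.pi * z)) (by fun_prop) hb norm_cos_pi_mul_le (2 * M)
    (w₀ := taylorCoef h (2 * M + 1)) (by
      rw [taylorCoef_cos_pi_odd]
      simp)
  obtain ⟨D', hgb'⟩ := exists_bound_comp_sub (1 / 2) hgb
  have hsum := hasSum_neg_one_zpow_mul_eq_zero
    (g := fun z => g (z - (1 / 2 : ℝ))) (by fun_prop) hgb'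
  have hsq : HasSum (fun k : ℤ => 1 / ((k : ℂ) - 1 / 2) ^ 2) ((Real.pi : ℂ) ^ 2) := by
    have := Complex.hasSum_ofReal.2 hasSum_one_div_int_sub_half_sq
    push_cast at this
    exact this
  have hfac : ((2 * M + 1).factorial : ℂ) ≠ 0 := by exact_mod_cast (2 * M + 1).factorial_ne_zero
  -- At the nodes the sine is `-(-1)^k`, so the correction loses its alternation and becomes a
  -- multiple of `1/(k - 1/2)²`, with sum `π²`.
  have h1 := (hsum.mul_left (-((2 * M + 1).factorial / (Real.pi : ℂ)))).add
    (hsq.mul_left ((2 * M + 1).factorial / (Real.pi : ℂ) ^ 2 * taylorCoef h (2 * M + 1)))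
  have h2 : ((2 * M + 1).factorial / (Real.pi : ℂ) ^ 2 * taylorCoef h (2 * M + 1)) *
      (Real.pi : ℂ) ^ 2 = iteratedDeriv (2 * M + 1) h 0 := by
    rw [taylorCoef]
    field_simp
  rw [mul_zero, zero_add, h2] at h1
  rw [show 2 * m - 1 = 2 * M + 1 by omega]
  refine h1.congr_fun fun k => ?_
  have hk : (k : ℂ) - 1 / 2 ≠ 0 := by
    intro h0
    have : (2 * k - 1 : ℂ) = 0 := by linear_combination 2 * h0
    have h3 : (2 * k - 1 : ℤ) = 0 := by exact_mod_cast this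
    omega
  have hpk : (Real.pi : ℂ) * (k - 1 / 2) = k * Real.pi - Real.pi / 2 := by ring
  have hc : Complex.cos (Real.pi * (k - 1 / 2)) = 0 := by
    rw [hpk, Complex.cos_sub_pi_div_two, Complex.sin_int_mul_pi]
  have hcos : Complex.cos (k * Real.pi) = (-1) ^ k := by
    rw [← Complex.ofReal_intCast, ← Complex.ofReal_mul, ← Complex.ofReal_cos,
      Real.cos_int_mul_pi]
    simp
  have hs : Complex.sin (Real.pi * (k - 1 / 2)) = -(-1) ^ k := by
    rw [hpk, Complex.sin_sub_pi_div_two, ← hcos]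
  have hsign : ((-1 : ℂ) ^ k) ^ 2 = 1 := by
    rw [← zpow_natCast, ← zpow_mul, mul_comm, zpow_mul]; simp
  have hg' := hg _ hk
  rw [hc, hs, taylorSum_cos_pi] at hg'
  rw [zpow_add₀ (by norm_num), zpow_one, Mellin11.coeffA]
  push_cast
  rw [hg', show 2 * m - 1 = 2 * M + 1 by omega, show 2 * m = 2 * M + 2 by omega, hM]
  generalize (k : ℂ) - 1 / 2 = κ
  linear_combination (((2 * M + 1).factorial / (Real.pi : ℂ)) * taylorCoef h (2 * M + 1) /
    (Real.pi * κ ^ 2)) * hsign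

/-! ### Entire extension of orbits with geometrically bounded derivatives. -/

open Filter Topology in
theorem hasSum_taylor_of_norm_le {u : ℕ → ℝ → ℂ} (hu : ∀ n t, HasDerivAt (u n) (u (n + 1) t) t)
    {C σ : ℝ} (hb : ∀ n t, ‖u n t‖ ≤ C * σ ^ n) (s : ℝ) :
    HasSum (fun j : ℕ => u j 0 / j.factorial * (s : ℂ) ^ j) (u 0 s) := by
  have hC : 0 ≤ C := by simpa using (norm_nonneg _).trans (hb 0 0)
  -- Taylor polynomial at `s` with moving base point `x`: its derivative in `x` telescopes to one
  -- term, and the mean value inequality between `0` and `s` bounds the remainder.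
  set ψ : ℕ → ℝ → ℂ := fun n x =>
    ∑ j ∈ Finset.range (n + 1), u j x / j.factorial * ((s : ℂ) - x) ^ j with hψ
  have hψd (n : ℕ) (x : ℝ) :
      HasDerivAt (ψ n) (u (n + 1) x / n.factorial * ((s : ℂ) - x) ^ n) x := by
    induction n with
    | zero => simpa [hψ] using hu 0 x
    | succ n ih =>
      have h1 : HasDerivAt (fun x : ℝ => (s : ℂ) - x) (-1) x := by
        simpa using (Complex.ofRealCLM.hasDerivAt (x := x)).const_sub (s : ℂ)
      have h1' : HasDerivAt (fun x : ℝ => ((s : ℂ) - x) ^ (n + 1))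
          ((n + 1 : ℕ) * ((s : ℂ) - x) ^ n * (-1)) x := by
        simpa using h1.fun_pow (n + 1)
      have h2 := ih.add (((hu (n + 1) x).div_const ((n + 1).factorial : ℂ)).mul h1')
      have h3 : ψ (n + 1) = ψ n + (fun x => u (n + 1) x / ((n + 1).factorial : ℂ)) *
          fun x : ℝ => ((s : ℂ) - x) ^ (n + 1) := by
        ext x
        simp only [hψ, Finset.sum_range_succ _ (n + 1), Pi.add_apply, Pi.mul_apply]
      rw [h3]
      refine h2.congr_deriv ?_
      have hf : (n.factorial : ℂ) ≠ 0 := by exact_mod_cast n.factorial_ne_zero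
      have hn : (n : ℂ) + 1 ≠ 0 := by exact_mod_cast n.succ_ne_zero
      rw [Nat.factorial_succ]
      push_cast
      field_simp
      ring
  have hψs (n : ℕ) : ψ n s = u 0 s := by
    simp only [hψ, sub_self, Finset.sum_range_succ']
    simp
  have hle (n : ℕ) : ‖u 0 s - ψ n 0‖ ≤
      C * |σ| * |s| * ((|σ| * |s|) ^ n / n.factorial) := by
    have hbound : ∀ x ∈ uIcc 0 s, ‖u (n + 1) x / n.factorial * ((s : ℂ) - x) ^ n‖ ≤
        C * |σ| ^ (n + 1) / n.factorial * |s| ^ n := by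
      intro x hx
      rw [norm_mul, norm_div, norm_pow, Complex.norm_natCast, ← Complex.ofReal_sub,
        Complex.norm_real, Real.norm_eq_abs]
      have h1 : |s - x| ≤ |s| := by
        have := abs_sub_left_of_mem_uIcc (a := s) (b := 0) (c := x) (uIcc_comm (0 : ℝ) s ▸ hx)
        simpa [abs_sub_comm] using this
      have h2 : ‖u (n + 1) x‖ ≤ C * |σ| ^ (n + 1) := (hb _ _).trans <|
        mul_le_mul_of_nonneg_left ((le_abs_self _).trans_eq (abs_pow σ _)) hC
      gcongr
    have := (convex_uIcc (0 : ℝ) s).norm_image_sub_le_of_norm_hasDerivWithin_le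
      (fun x _ => (hψd n x).hasDerivWithinAt) hbound left_mem_uIcc right_mem_uIcc
    rw [hψs, sub_zero, Real.norm_eq_abs] at this
    refine this.trans_eq ?_
    ring
  have hsummable : Summable fun j : ℕ => u j 0 / j.factorial * (s : ℂ) ^ j := by
    refine Summable.of_norm_bounded
      ((Real.summable_pow_div_factorial (σ * |s|)).mul_left C) fun j => ?_
    rw [norm_mul, norm_div, norm_pow, Complex.norm_natCast, Complex.norm_real, Real.norm_eq_abs]
    calc _ ≤ C * σ ^ j / j.factorial * |s| ^ j := by gcongr; exact hb j 0
      _ = _ := by rw [mul_pow]; ring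
  have hlim : Tendsto (fun n => ψ n 0) atTop (𝓝 (u 0 s)) := by
    rw [tendsto_iff_norm_sub_tendsto_zero]
    have h0 : Tendsto (fun n : ℕ => C * |σ| * |s| * ((|σ| * |s|) ^ n / n.factorial)) atTop
        (𝓝 0) := by
      simpa using (FloorSemiring.tendsto_pow_div_factorial_atTop (|σ| * |s|)).const_mul
        (C * |σ| * |s|)
    refine squeeze_zero (fun _ => norm_nonneg _) (fun n => ?_) h0
    rw [norm_sub_rev]
    exact hle n
  have h1 := (tendsto_add_atTop_iff_nat 1).2 hsummable.hasSum.tendsto_sum_nat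
  have h2 : (fun n => ψ n 0) =
      fun n => ∑ j ∈ Finset.range (n + 1), u j 0 / j.factorial * (s : ℂ) ^ j := by
    ext n
    simp [hψ]
  rw [h2] at hlim
  exact hsummable.hasSum_iff.2 (tendsto_nhds_unique h1 hlim)

/-- A sequence of successive derivatives growing at most geometrically comes from an entire
function of exponential type. -/
theorem exists_entire_extension {u : ℕ → ℝ → ℂ} (hu : ∀ n t, HasDerivAt (u n) (u (n + 1) t) t)
    {C σ : ℝ} (hb : ∀ n t, ‖u n t‖ ≤ C * σ ^ n) :
    ∃ H : ℂ → ℂ, Differentiable ℂ H ∧ (∀ n (t : ℝ), iteratedDeriv n H t = u n t) ∧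
      ∀ z : ℂ, ‖H z‖ ≤ C * Real.exp (σ * |z.im|) := by
  have hC : 0 ≤ C := by simpa using (norm_nonneg _).trans (hb 0 0)
  set H : ℂ → ℂ := fun z => ∑' j : ℕ, u j 0 / j.factorial * z ^ j with hH
  have hterm (j : ℕ) {z : ℂ} {R : ℝ} (hz : ‖z‖ ≤ R) :
      ‖u j 0 / j.factorial * z ^ j‖ ≤ C * ((σ * R) ^ j / j.factorial) := by
    rw [norm_mul, norm_div, norm_pow, Complex.norm_natCast]
    have h0 : 0 ≤ C * σ ^ j := (norm_nonneg _).trans (hb j 0)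
    calc _ ≤ C * σ ^ j / j.factorial * R ^ j := by gcongr; exact hb j 0
      _ = _ := by rw [mul_pow]; ring
  have hHd : Differentiable ℂ H := fun z => by
    have := Complex.differentiableOn_tsum_of_summable_norm (U := Metric.ball 0 (‖z‖ + 1))
      (F := fun (j : ℕ) (z : ℂ) => u j 0 / j.factorial * z ^ j)
      ((Real.summable_pow_div_factorial (σ * (‖z‖ + 1))).mul_left C)
      (fun j => by fun_prop) Metric.isOpen_ball
      fun j w hw => hterm j (by simpa using (mem_ball_zero_iff.1 hw).le)
    exact this.differentiableAt (Metric.isOpen_ball.mem_nhds (by simp))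
  have hHu (n : ℕ) : ∀ t : ℝ, iteratedDeriv n H t = u n t := by
    induction n with
    | zero => intro t; simpa using (hasSum_taylor_of_norm_le hu hb t).tsum_eq
    | succ n ih =>
      intro t
      have hd : DifferentiableAt ℂ (iteratedDeriv n H) t :=
        (hHd.contDiff (n := (n + 1 : ℕ))).differentiable_iteratedDeriv n
          (by exact_mod_cast n.lt_succ_self) _
      have h1 := hd.hasDerivAt.comp_ofReal
      have h2 : (fun y : ℝ => iteratedDeriv n H y) = u n := funext ih
      rw [h2] at h1
      rw [iteratedDeriv_succ]
      exact h1.unique (hu n t)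
  refine ⟨H, hHd, hHu, fun z => ?_⟩
  -- Expanding about `Re z` instead of `0` makes the bound depend on `|Im z|` only.
  have h1 := Complex.hasSum_taylorSeries_of_entire hHd (z.re : ℂ) z
  have h2 : HasSum (fun n : ℕ => C * ((σ * |z.im|) ^ n / n.factorial))
      (C * Real.exp (σ * |z.im|)) := by
    rw [Real.exp_eq_exp_ℝ]
    exact (NormedSpace.expSeries_div_hasSum_exp (σ * |z.im|)).mul_left C
  rw [← h1.tsum_eq]
  refine tsum_of_norm_bounded h2 fun n => ?_
  have h3 : ‖z - z.re‖ = |z.im| := by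
    have : z - z.re = z.im * Complex.I := by
      apply Complex.ext <;> simp
    rw [this, norm_mul, Complex.norm_real, Complex.norm_I, mul_one, Real.norm_eq_abs]
  rw [smul_eq_mul, smul_eq_mul, norm_mul, norm_mul, norm_inv, Complex.norm_natCast, norm_pow, h3,
    hHu]
  calc _ ≤ ((n.factorial : ℝ))⁻¹ * (|z.im| ^ n * (C * σ ^ n)) := by gcongr; exact hb n _
    _ = _ := by rw [mul_pow]; ring

/-! ### Absolute summability of the coefficients. -/

theorem Complex.cos_pi_mul_int (k : ℤ) : Complex.cos (Real.pi * k) = (-1) ^ k := by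
  rw [mul_comm, ← Complex.ofReal_intCast, ← Complex.ofReal_mul, ← Complex.ofReal_cos,
    Real.cos_int_mul_pi]
  simp

theorem neg_one_zpow_mul_self (k : ℤ) : (-1 : ℂ) ^ k * (-1) ^ k = 1 := by
  rw [← mul_zpow]; simp

/-- Sampling `sin πz` cancels the signs, so its series is that of the bare coefficients; for real
series summability is absolute. -/
theorem summable_norm_coeffA {m : ℕ} (hm : m ≠ 0) :
    Summable fun k : ℤ => ‖Mellin11.coeffA m k‖ := by
  have h := (hasSum_coeffA (h := fun z => Complex.sin (Real.pi * z)) (by fun_prop)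
    norm_sin_pi_mul_le hm).summable
  refine (Complex.summable_ofReal.1 (h.congr fun k => ?_)).norm
  rw [mul_sub, mul_one_div, Complex.sin_sub_pi_div_two, Complex.cos_pi_mul_int,
    zpow_add₀ (by norm_num), zpow_one]
  linear_combination (Mellin11.coeffA m k : ℂ) * neg_one_zpow_mul_self k

theorem summable_norm_coeffB {m : ℕ} (hm : m ≠ 0) :
    Summable fun k : ℤ => ‖Mellin11.coeffB m k‖ := by
  have h := (hasSum_coeffB (h := fun z => Complex.cos (Real.pi * z)) (by fun_prop)
    norm_cos_pi_mul_le hm).summable.neg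
  refine (Complex.summable_ofReal.1 (h.congr fun k => ?_)).norm
  rw [Complex.cos_pi_mul_int, zpow_add₀ (by norm_num), zpow_one]
  linear_combination (Mellin11.coeffB m k : ℂ) * neg_one_zpow_mul_self k

/-! ### The group `U` and the Riesz-Boas series. -/

namespace Mellin11


theorem norm_U {p : ℝ≥0∞} (t : ℝ) (f : X p) : ‖U t f‖ = ‖f‖ :=
  Lp.norm_compMeasurePreserving f (measurePreserving_dilation t)

theorem U_add {p : ℝ≥0∞} (t s : ℝ) (f : X p) : U (t + s) f = U t (U s f) := by
  have h : (fun x : ℝ => Real.exp (t + s) * x) =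
      (fun x => Real.exp s * x) ∘ fun x => Real.exp t * x := by
    ext x
    simp only [Function.comp_apply, Real.exp_add]
    ring
  unfold U
  rw [← Lp.compMeasurePreserving_comp_apply]
  congr!

/-- The group law carries differentiability at `0` to every `t`, through the bounded operator `U t`.
-/
theorem hasDerivAt_U {p : ℝ≥0∞} [Fact (1 ≤ p)] {f : X p} (hf : InDomain f) (t : ℝ) :
    HasDerivAt (fun s => U s f) (U t (Theta f)) t := by
  have h0 : HasDerivAt (fun s => U s f) (Theta f) 0 := DifferentiableAt.hasDerivAt hf
  let L : X p →L[ℝ] X p := (Lp.compMeasurePreservingₗᵢ ℝ _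
    (measurePreserving_dilation t)).toContinuousLinearMap
  have h1 : HasDerivAt (fun s => U t (U s f)) (U t (Theta f)) 0 := by
    have h := HasFDerivAt.comp_hasDerivAt (0 : ℝ) (L.hasFDerivAt (x := U 0 f)) h0
    exact h
  simp only [← U_add] at h1
  rw [← neg_add_cancel t] at h1
  simpa using h1.comp_const_add (-t) t

/-- The term of the Riesz-Boas series against a functional is a sampling series of an entire
function of exponential type, which sums to a derivative. -/
theorem hasSum_apply_rieszBoasTerm {p : ℝ≥0∞} [Fact (1 ≤ p)] {σ : ℝ} {f : X p}
    (hf : f ∈ bernstein p σ) {τ : ℝ} (hτ0 : 0 < τ) (hτ : σ ≤ τ) {r : ℕ} (hr : 1 ≤ r) (φ : StrongDual ℂ (X p)) :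
    HasSum (fun k => φ (rieszBoasTerm r τ f k)) (φ (U 0 (Theta^[r] f))) := by
  have hdom (n : ℕ) : InDomain (Theta^[n] f) := mem_iInter.1 hf.1 (n + 1) n n.lt_succ_self
  obtain ⟨H, hHd, hHu, hHb⟩ := exists_entire_extension
    (u := fun n t => φ (U t (Theta^[n] f))) (C := ‖φ‖ * ‖f‖) (σ := σ)
    (fun n t => by
      have := (φ.restrictScalars ℝ).hasFDerivAt.comp_hasDerivAt t (hasDerivAt_U (hdom n) t)
      rw [← Function.iterate_succ_apply' Theta] at this
      exact this)
    (fun n t => by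
      refine (φ.le_opNorm _).trans ?_
      rw [norm_U, mul_assoc, mul_comm ‖f‖]
      gcongr
      exact hf.2 n)
  have hpi := Real.pi_pos
  set c : ℝ := Real.pi / τ with hc
  have hc0 : 0 < c := by positivity
  have hhd : Differentiable ℂ fun z => H (c * z) := by fun_prop
  -- This is where `σ ≤ τ` enters: the rescaled type `σπ/τ` is at most `π`.
  have hhb (z : ℂ) : ‖H (c * z)‖ ≤ ‖φ‖ * ‖f‖ * Real.exp (Real.pi * |z.im|) := by
    refine (hHb _).trans ?_
    rw [Complex.im_ofReal_mul, abs_mul, abs_of_pos hc0, ← mul_assoc]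
    gcongr
    rw [hc, mul_div_left_comm]
    exact mul_le_of_le_one_right hpi.le ((div_le_one hτ0).2 hτ)
  have hH0 (t : ℝ) : H t = φ (U t f) := by simpa using hHu 0 t
  have hderiv (n : ℕ) : iteratedDeriv n (fun z => H (c * z)) 0 =
      (c : ℂ) ^ n * φ (U 0 (Theta^[n] f)) := by
    rw [iteratedDeriv_comp_const_mul hHd.contDiff]
    beta_reduce
    rw [mul_zero, ← Complex.ofReal_zero, hHu]
  have hscale (n : ℕ) (x : ℂ) : ((τ / Real.pi : ℝ) : ℂ) ^ n * ((c : ℂ) ^ n * x) = x := by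
    rw [← mul_assoc, ← mul_pow, ← Complex.ofReal_mul, hc,
      show τ / Real.pi * (Real.pi / τ) = 1 by field_simp]
    simp
  rcases Nat.even_or_odd r with hev | hodd
  · obtain ⟨m, hm⟩ := hev.two_dvd
    have h := (hasSum_coeffB hhd hhb (m := m) (by omega)).mul_left
      (((τ / Real.pi : ℝ) : ℂ) ^ r)
    rw [← hm, hderiv, hscale] at h
    refine h.congr_fun fun k => ?_
    have hk : (c : ℂ) * k = ((Real.pi * k / τ : ℝ) : ℂ) := by rw [hc]; push_cast; ring
    rw [rieszBoasTerm, if_neg (Nat.not_odd_iff_even.2 hev), φ.map_smul_of_tower,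
      Complex.real_smul, hk, hH0, show r / 2 = m by omega]
    push_cast
    ring
  · obtain ⟨m, hm⟩ := hodd
    have h := (hasSum_coeffA hhd hhb (m := m + 1) (by omega)).mul_left
      (((τ / Real.pi : ℝ) : ℂ) ^ r)
    rw [show 2 * (m + 1) - 1 = r by omega, hderiv, hscale] at h
    refine h.congr_fun fun k => ?_
    have hk : (c : ℂ) * (k - 1 / 2) = ((Real.pi / τ * (k - 1 / 2) : ℝ) : ℂ) := by
      rw [hc]; push_cast; ring
    rw [rieszBoasTerm, if_pos ⟨m, hm⟩, φ.map_smul_of_tower,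
      Complex.real_smul, hk, hH0, show (r + 1) / 2 = m + 1 by omega]
    push_cast
    ring

theorem summable_rieszBoasTerm {p : ℝ≥0∞} [Fact (1 ≤ p)] (f : X p) (τ : ℝ) {r : ℕ} (hr : 1 ≤ r) :
    Summable (rieszBoasTerm r τ f) := by
  have hnorm (a : ℝ) (k : ℤ) (b t : ℝ) :
      ‖(a ^ r * ((-1 : ℝ) ^ (k + 1) * b)) • U t f‖ = |a| ^ r * ‖f‖ * ‖b‖ := by
    rw [norm_smul, norm_U, norm_mul, norm_mul, norm_pow, norm_zpow, norm_neg, norm_one, one_zpow,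
      Real.norm_eq_abs]
    ring
  rcases Nat.even_or_odd r with hev | hodd
  · refine Summable.of_norm_bounded ((summable_norm_coeffB (m := r / 2)
      (by have := hev.two_dvd; omega)).mul_left (|τ / Real.pi| ^ r * ‖f‖)) fun k => ?_
    rw [rieszBoasTerm, if_neg (Nat.not_odd_iff_even.2 hev), hnorm]
  · refine Summable.of_norm_bounded ((summable_norm_coeffA (m := (r + 1) / 2)
      (by omega)).mul_left (|τ / Real.pi| ^ r * ‖f‖)) fun k => ?_
    rw [rieszBoasTerm, if_pos hodd, hnorm]

/-- On the Bernstein space the Riesz-Boas operators are powers of the generator. -/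
theorem rieszBoas_eq {p : ℝ≥0∞} [Fact (1 ≤ p)] {σ : ℝ} {f : X p}
    (hf : f ∈ bernstein p σ) {τ : ℝ} (hτ0 : 0 < τ) (hτ : σ ≤ τ) {r : ℕ} (hr : 1 ≤ r) :
    rieszBoas r τ f = U 0 (Theta^[r] f) := by
  rw [SeparatingDual.eq_iff_forall_dual_eq (R := ℂ)]
  intro φ
  exact ((summable_rieszBoasTerm f τ hr).hasSum.mapL φ).unique
    (hasSum_apply_rieszBoasTerm hf hτ0 hτ hr φ)

end Mellin11

theorem mainTheorem11 (p : ENNReal) [Fact (1 ≤ p)] (hp1 : 1 < p) (hp : p < ⊤)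
    (σ : ℝ) (hσ : 0 < σ) (f : Mellin11.X p) (hf : f ∈ Mellin11.bernstein p σ)
    (σ₁ σ₂ : ℝ) (h₁ : σ ≤ σ₁) (h₂ : σ ≤ σ₂) (r : ℕ) (hr : 1 ≤ r) :
    Summable (Mellin11.rieszBoasTerm r σ₁ f) ∧
      Summable (Mellin11.rieszBoasTerm r σ₂ f) ∧
      Mellin11.rieszBoas r σ₁ f = Mellin11.rieszBoas r σ₂ f := by
  refine ⟨Mellin11.summable_rieszBoasTerm f σ₁ hr, Mellin11.summable_rieszBoasTerm f σ₂ hr, ?_⟩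
  rw [Mellin11.rieszBoas_eq hf (hσ.trans_le h₁) h₁ hr,
    Mellin11.rieszBoas_eq hf (hσ.trans_le h₂) h₂ hr]
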